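/- Let $N\ge 1$. Define differential polynomials $L_k[u]$ by $L_0[u]=\tfrac12$ and the Lenard recursion $$\frac{d}{dz}L_{k+1}[u]=\Big(\frac{d^3}{dz^3}+4u\frac{d}{dz}+2u_z\Big)L_k[u],\qquad k\ge 0,$$ where every $L_{k}[u]$ with $k\ge1$ is taken without constant term. The $N$-th equation of the second Painlevé hierarchy with parameter $\alpha$ is $$P_2^{(N)}[w,\alpha]=\Big(\frac{d}{dz}+2w\Big)L_N[w'-w^2]-zw-\alpha=0 .$$ For $\alpha\in\mathbb C$ let $$w(z;\alpha)=\sum_{m=0}^{\infty}c_{\alpha,-(m+1)}\,z^{-m-1}$$ be the expansion at infinity of its (unique) formal solution of this form. Let $Q_0=1$, and let $Q_1,Q_2,\dots$ be the monic complex polynomials such that for every $i\ge 1$ the rational function $$w=\frac{d}{dz}\ln\frac{Q_{i-1}(z)}{Q_i(z)}$$ is a solution of $P_2^{(N)}[w,i]=0$. Let $p_n$ be the degree of $Q_n$, let $a_{n,1},\dots,a_{n,p_n}$ be its complex roots, listed with multiplicity, and let $s_{n,m}=\sum_{k=1}^{p_n}a_{n,k}^m$. Then for each $n\ge 2$ $$s_{n,m}=-\sum_{i=2}^{n}c_{i,-(m+1)}\quad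 (m\ge 1),\qquad\text{and}\qquad p_n=-\sum_{i=1}^{n}c_{i,-1}.$$ -/

import Mathlib

open Polynomial

noncomputable section

namespace PIIHierarchy

/-! ### Differential polynomials and the Lenard recursion -/

/-- Differential polynomials in one unknown `u`; the variable `X j` stands for the `j`-th
derivative of `u`. -/
abbrev DiffPoly : Type := MvPolynomial ℕ ℂ

/-- The total derivative on differential polynomials: the derivation with `u^(j) ↦ u^(j+1)`. -/
def totalDeriv : Derivation ℂ DiffPoly DiffPoly :=
  MvPolynomial.mkDerivation ℂ (fun j => MvPolynomial.X (j + 1))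

/-- The Lenard sequence `L_0 = 1/2`, `d L_{N+1} = (d^3 + 4 u d + 2 u_z) L_N`. The recursion fixes
each `L_{N+1}` up to an additive constant, and the constant term is taken to be zero. -/
structure IsLenardSequence (L : ℕ → DiffPoly) : Prop where
  zero : L 0 = MvPolynomial.C (1 / 2)
  succ : ∀ N, totalDeriv (L (N + 1)) =
    totalDeriv (totalDeriv (totalDeriv (L N))) + 4 * MvPolynomial.X 0 * totalDeriv (L N)
      + 2 * MvPolynomial.X 1 * L N
  constantCoeff : ∀ N, MvPolynomial.constantCoeff (L (N + 1)) = 0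

/-- An auxiliary explicit sequence, used only to show that the Lenard sequence exists. -/
def lenardAux : ℕ → DiffPoly
  | 0 => MvPolynomial.C (1 / 2)
  | n + 1 =>
    (∑ j : Fin (n + 1),
      (2 * lenardAux j * totalDeriv (totalDeriv (lenardAux (n - j)))
        - totalDeriv (lenardAux j) * totalDeriv (lenardAux (n - j))
        + 4 * MvPolynomial.X 0 * (lenardAux j * lenardAux (n - j))))
    - ∑ k : Fin n, lenardAux (k + 1) * lenardAux (n - k)
termination_by n => n
decreasing_by all_goals omega

theorem constantCoeff_totalDeriv (P : DiffPoly) :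
    MvPolynomial.constantCoeff (totalDeriv P) = 0 := by
  induction P using MvPolynomial.induction_on with
  | C a => simp [totalDeriv]
  | add p q hp hq => simp [hp, hq]
  | mul_X p n hp => simp [Derivation.leibniz, totalDeriv]

theorem constantCoeff_lenardAux (N : ℕ) :
    MvPolynomial.constantCoeff (lenardAux (N + 1)) = 0 := by
  induction N using Nat.strong_induction_on with
  | _ n ih =>
    rw [lenardAux]
    have h : ∀ k : Fin n, MvPolynomial.constantCoeff (lenardAux (k + 1)) = 0 :=
      fun k => ih k k.2
    simp [constantCoeff_totalDeriv, h]

/-- The total derivative applied to every coefficient of a power series. -/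
def coeffDeriv (f : PowerSeries DiffPoly) : PowerSeries DiffPoly :=
  PowerSeries.mk fun n => totalDeriv (PowerSeries.coeff n f)

theorem coeffDeriv_add (f g : PowerSeries DiffPoly) :
    coeffDeriv (f + g) = coeffDeriv f + coeffDeriv g := by
  ext1 n; simp [coeffDeriv]

theorem coeffDeriv_sub (f g : PowerSeries DiffPoly) :
    coeffDeriv (f - g) = coeffDeriv f - coeffDeriv g := by
  ext1 n; simp [coeffDeriv]

theorem coeffDeriv_mul (f g : PowerSeries DiffPoly) :
    coeffDeriv (f * g) = f * coeffDeriv g + g * coeffDeriv f := by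
  rw [mul_comm g]
  ext1 n
  simp only [coeffDeriv, PowerSeries.coeff_mk, PowerSeries.coeff_mul, map_sum, map_add,
    Derivation.leibniz, Finset.sum_add_distrib, smul_eq_mul]
  congr 1
  exact Finset.sum_congr rfl fun x _ => mul_comm _ _

theorem coeffDeriv_C (a : DiffPoly) :
    coeffDeriv (PowerSeries.C a) = PowerSeries.C (totalDeriv a) := by
  ext1 n
  simp only [coeffDeriv, PowerSeries.coeff_mk, PowerSeries.coeff_C]
  split_ifs <;> simp

theorem coeffDeriv_X : coeffDeriv (PowerSeries.X : PowerSeries DiffPoly) = 0 := by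
  ext1 n
  simp only [coeffDeriv, PowerSeries.coeff_mk, PowerSeries.coeff_X]
  split_ifs <;> simp

theorem isLenardSequence_lenardAux : IsLenardSequence lenardAux := by
  refine ⟨by rw [lenardAux], ?_, constantCoeff_lenardAux⟩
  set G : PowerSeries DiffPoly := PowerSeries.mk lenardAux with hG
  set u : PowerSeries DiffPoly := PowerSeries.C (MvPolynomial.X 0) with hu
  have h0 : lenardAux 0 = MvPolynomial.C (1 / 2) := by rw [lenardAux]
  have key : G * G - PowerSeries.X * (2 * G * coeffDeriv (coeffDeriv G)
      - coeffDeriv G * coeffDeriv G + 4 * u * (G * G))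
      = PowerSeries.C (MvPolynomial.C (1 / 4)) := by
    ext1 n
    cases n with
    | zero =>
      simp only [map_sub, PowerSeries.coeff_zero_eq_constantCoeff, map_mul,
        PowerSeries.constantCoeff_X, zero_mul, sub_zero, PowerSeries.constantCoeff_C]
      rw [← PowerSeries.coeff_zero_eq_constantCoeff_apply, hG, PowerSeries.coeff_mk, h0,
        ← MvPolynomial.C_mul]
      norm_num
    | succ n =>
      have hc : ∀ f : PowerSeries DiffPoly, 2 * G * f = PowerSeries.C 2 * (G * f) := by
        intro f; rw [mul_assoc]; congr 1
      have hc4 : 4 * u * (G * G) = PowerSeries.C (4 * MvPolynomial.X 0) * (G * G) := by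
        rw [hu, map_mul]; congr 1
      rw [map_sub, PowerSeries.coeff_succ_X_mul, map_add, map_sub, hc, hc4,
        PowerSeries.coeff_C_mul, PowerSeries.coeff_C_mul, PowerSeries.coeff_C,
        if_neg (Nat.succ_ne_zero n)]
      simp only [PowerSeries.coeff_mul, hG, coeffDeriv, PowerSeries.coeff_mk]
      simp only [Finset.Nat.sum_antidiagonal_eq_sum_range_succ_mk]
      rw [Finset.sum_range_succ, Finset.sum_range_succ']
      have e : lenardAux (n + 1) = (∑ j ∈ Finset.range (n + 1),
          (2 * lenardAux j * totalDeriv (totalDeriv (lenardAux (n - j)))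
            - totalDeriv (lenardAux j) * totalDeriv (lenardAux (n - j))
            + 4 * MvPolynomial.X 0 * (lenardAux j * lenardAux (n - j))))
          - ∑ k ∈ Finset.range n, lenardAux (k + 1) * lenardAux (n - k) := by
        rw [lenardAux, Finset.sum_range, Finset.sum_range]
      have e2 : ∑ k ∈ Finset.range n, lenardAux (k + 1) * lenardAux (n + 1 - (k + 1))
          = ∑ k ∈ Finset.range n, lenardAux (k + 1) * lenardAux (n - k) :=
        Finset.sum_congr rfl fun k _ => by rw [Nat.add_sub_add_right]
      have half : (MvPolynomial.C (1 / 2) : DiffPoly) + MvPolynomial.C (1 / 2) = 1 := by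
        rw [← MvPolynomial.C_add]; norm_num
      rw [e2, Nat.sub_self, Nat.sub_zero, h0]
      have e3 := e
      rw [Finset.sum_add_distrib, Finset.sum_sub_distrib, ← Finset.mul_sum] at e3
      simp only [mul_assoc, ← Finset.mul_sum] at e3 ⊢
      linear_combination (lenardAux (n + 1)) * half + e3
  have hd := congrArg coeffDeriv key
  have c2 : coeffDeriv (2 : PowerSeries DiffPoly) = 0 := by
    rw [show (2 : PowerSeries DiffPoly) = PowerSeries.C (MvPolynomial.C 2) from rfl, coeffDeriv_C]
    simp
  have c4 : coeffDeriv (4 : PowerSeries DiffPoly) = 0 := by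
    rw [show (4 : PowerSeries DiffPoly) = PowerSeries.C (MvPolynomial.C 4) from rfl, coeffDeriv_C]
    simp
  have cr : coeffDeriv (PowerSeries.C (MvPolynomial.C (1 / 4)) : PowerSeries DiffPoly) = 0 := by
    rw [coeffDeriv_C]; simp
  rw [cr] at hd
  simp only [coeffDeriv_add, coeffDeriv_sub, coeffDeriv_mul, coeffDeriv_X, c2, c4] at hd
  have hG0 : G ≠ 0 := by
    intro h
    have := congrArg (PowerSeries.coeff 0) h
    rw [hG, PowerSeries.coeff_mk, h0] at this
    simp at this
  have hfac : (2 * G) * (coeffDeriv G - PowerSeries.X * (coeffDeriv (coeffDeriv (coeffDeriv G))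
      + 4 * u * coeffDeriv G + 2 * coeffDeriv u * G)) = 0 := by
    linear_combination hd
  have h2 : (2 : PowerSeries DiffPoly) ≠ 0 := by
    intro h
    have := congrArg (PowerSeries.coeff 0) h
    rw [show (2 : PowerSeries DiffPoly) = PowerSeries.C 2 from rfl, PowerSeries.coeff_C] at this
    simp at this
  have hlen := (mul_eq_zero.mp hfac).resolve_left (mul_ne_zero h2 hG0)
  intro N
  have hN := congrArg (PowerSeries.coeff (N + 1)) hlen
  rw [map_sub, PowerSeries.coeff_succ_X_mul, hu, coeffDeriv_C,
    show (4 : PowerSeries DiffPoly) = PowerSeries.C 4 from rfl,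
    show (2 : PowerSeries DiffPoly) = PowerSeries.C 2 from rfl, ← map_mul, ← map_mul,
    map_add, map_add, PowerSeries.coeff_C_mul, PowerSeries.coeff_C_mul, map_zero] at hN
  have hX : totalDeriv (MvPolynomial.X 0) = MvPolynomial.X 1 := by simp [totalDeriv]
  simp only [hG, coeffDeriv, PowerSeries.coeff_mk, hX] at hN
  exact sub_eq_zero.mp hN

theorem exists_isLenardSequence : ∃ L, IsLenardSequence L := ⟨_, isLenardSequence_lenardAux⟩

/-- The Lenard differential polynomial `L_N[u]`. -/
def lenard : ℕ → DiffPoly := exists_isLenardSequence.choose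

theorem isLenardSequence_lenard : IsLenardSequence lenard := exists_isLenardSequence.choose_spec

/-! ### The hierarchy -/

/-- The left-hand side `(d + 2 w) L_N[w' - w^2] - z w - α` of the `N`-th equation, in a commutative
algebra `A` whose elements are differentiated (with respect to `z`) by `d`. -/
def painleveTwo {A : Type*} [CommRing A] [Algebra ℂ A] (d : A → A) (z : A) (N : ℕ) (α : ℂ)
    (w : A) : A :=
  let ℓ : A := MvPolynomial.aeval (fun j : ℕ => d^[j] (d w - w ^ 2)) (lenard N)
  d ℓ + 2 * w * ℓ - z * w - algebraMap ℂ A α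

/-! ### Rational solutions and their polynomials -/

/-- The derivative of a rational function, by the quotient rule. -/
def ratDeriv (f : RatFunc ℂ) : RatFunc ℂ :=
  (algebraMap ℂ[X] (RatFunc ℂ) (derivative f.num) * algebraMap ℂ[X] (RatFunc ℂ) f.denom
    - algebraMap ℂ[X] (RatFunc ℂ) f.num * algebraMap ℂ[X] (RatFunc ℂ) (derivative f.denom))
    / algebraMap ℂ[X] (RatFunc ℂ) f.denom ^ 2

/-- The logarithmic derivative of `P / Q`, that is `f' / f` for the rational function
`f = P / Q`. -/
def logDerivQuot (P Q : ℂ[X]) : RatFunc ℂ :=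
  ratDeriv (algebraMap ℂ[X] (RatFunc ℂ) P / algebraMap ℂ[X] (RatFunc ℂ) Q)
    / (algebraMap ℂ[X] (RatFunc ℂ) P / algebraMap ℂ[X] (RatFunc ℂ) Q)

/-- `IsYablonskiiVorobev N n Q`: the polynomial `Q` is the `n`-th Yablonskii--Vorob'ev polynomial
of the `N`-th equation. The first one is `Q_0 = 1`, and `Q_{n+1}` is monic and such that
`w = d/dz log (Q_n / Q_{n+1})` solves the `N`-th equation with parameter `α = n + 1`. -/
inductive IsYablonskiiVorobev (N : ℕ) : ℕ → ℂ[X] → Prop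
  | zero : IsYablonskiiVorobev N 0 1
  | succ {n : ℕ} {P Q : ℂ[X]} (hP : IsYablonskiiVorobev N n P) (hQ : Q.Monic)
      (hw : painleveTwo ratDeriv RatFunc.X N (n + 1 : ℂ) (logDerivQuot P Q) = 0) :
      IsYablonskiiVorobev N (n + 1) Q

/-- The sum of the `m`-th powers of the complex roots of `Q`, with multiplicity. -/
def rootPowerSum (Q : ℂ[X]) (m : ℕ) : ℂ := (Q.roots.map fun a => a ^ m).sum

/-! ### The expansion at infinity

Formal series at `z = ∞` are Laurent series in `t = 1 / z`. -/

/-- The function `z = t⁻¹`. -/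
def zInf : LaurentSeries ℂ := HahnSeries.single (-1) 1

/-- The derivation `d/dz = - t ^ 2 d/dt`. -/
def derivInf (f : LaurentSeries ℂ) : LaurentSeries ℂ :=
  -(HahnSeries.single 2 1 * LaurentSeries.derivative ℂ f)

/-- The formal series `∑_{m ≥ 0} c_m z^(-m-1)`. -/
def seriesInf (c : ℕ → ℂ) : LaurentSeries ℂ :=
  HahnSeries.single 1 1 * HahnSeries.ofPowerSeries ℤ ℂ (PowerSeries.mk c)

/-- The coefficients `c` are those of a formal solution `w = ∑_{m ≥ 0} c_m z^(-m-1)` of the `N`-th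
equation with parameter `α`. -/
def IsFormalSolution (N : ℕ) (α : ℂ) (c : ℕ → ℂ) : Prop :=
  painleveTwo derivInf zInf N α (seriesInf c) = 0

/-- The derivation `- t ^ 2 d/dt` on power series in `t`. -/
def psDeriv (f : PowerSeries ℂ) : PowerSeries ℂ :=
  -(PowerSeries.X ^ 2 * PowerSeries.derivative ℂ f)

theorem derivInf_ofPowerSeries (f : PowerSeries ℂ) :
    derivInf (HahnSeries.ofPowerSeries ℤ ℂ f) = HahnSeries.ofPowerSeries ℤ ℂ (psDeriv f) := by
  have h : LaurentSeries.derivative ℂ (HahnSeries.ofPowerSeries ℤ ℂ f)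
      = HahnSeries.ofPowerSeries ℤ ℂ (PowerSeries.derivative ℂ f) := by
    ext n
    rw [LaurentSeries.derivative_apply, LaurentSeries.hasseDeriv_coeff]
    rw [PowerSeries.coeff_coe, PowerSeries.coeff_coe, Ring.choose_one_right, Nat.cast_one]
    rcases lt_or_ge n 0 with hn | hn
    · rw [if_pos hn]
      rcases eq_or_ne (n + 1) 0 with h | h
      · rw [h, zero_smul]
      · rw [if_pos (by omega), smul_zero]
    · obtain ⟨k, rfl⟩ := Int.eq_ofNat_of_zero_le hn
      rw [if_neg (by omega), if_neg (by omega), PowerSeries.coeff_derivative,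
        show ((k : ℤ) + 1).natAbs = k + 1 by omega, Int.natAbs_natCast, zsmul_eq_mul, mul_comm]
      push_cast
      rfl
  rw [derivInf, psDeriv, h, map_neg, map_mul, HahnSeries.ofPowerSeries_X_pow]
  rfl

/-- The map whose fixed points are the coefficient series of the formal solutions. -/
def picard (N : ℕ) (α : ℂ) (c : PowerSeries ℂ) : PowerSeries ℂ :=
  let w : PowerSeries ℂ := PowerSeries.X * c
  let ℓ : PowerSeries ℂ :=
    MvPolynomial.aeval (fun j : ℕ => psDeriv^[j] (psDeriv w - w ^ 2)) (lenard N)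
  psDeriv ℓ + 2 * w * ℓ - PowerSeries.C α

theorem painleveTwo_seriesInf (N : ℕ) (α : ℂ) (c : ℕ → ℂ) :
    painleveTwo derivInf zInf N α (seriesInf c) =
      HahnSeries.ofPowerSeries ℤ ℂ (picard N α (PowerSeries.mk c) - PowerSeries.mk c) := by
  have hw : seriesInf c
      = HahnSeries.ofPowerSeries ℤ ℂ (PowerSeries.X * PowerSeries.mk c) := by
    rw [seriesInf, map_mul, HahnSeries.ofPowerSeries_X]
  have hz : zInf * seriesInf c = HahnSeries.ofPowerSeries ℤ ℂ (PowerSeries.mk c) := by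
    rw [zInf, seriesInf, ← mul_assoc, HahnSeries.single_mul_single]
    simp
  have hit : ∀ (j : ℕ) (f : PowerSeries ℂ), derivInf^[j] (HahnSeries.ofPowerSeries ℤ ℂ f)
      = HahnSeries.ofPowerSeries ℤ ℂ (psDeriv^[j] f) := by
    intro j
    induction j with
    | zero => intro f; rfl
    | succ j ih => intro f; rw [Function.iterate_succ_apply, Function.iterate_succ_apply,
        derivInf_ofPowerSeries, ih]
  have hα : ∀ r : ℂ, algebraMap ℂ (LaurentSeries ℂ) r
      = HahnSeries.ofPowerSeries ℤ ℂ (PowerSeries.C r) := by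
    intro r
    rw [HahnSeries.algebraMap_apply', PowerSeries.algebraMap_eq]
  have hae : ∀ (g : ℕ → PowerSeries ℂ) (P : DiffPoly),
      MvPolynomial.aeval (fun j => HahnSeries.ofPowerSeries ℤ ℂ (g j)) P
        = HahnSeries.ofPowerSeries ℤ ℂ (MvPolynomial.aeval g P) := by
    intro g P
    induction P using MvPolynomial.induction_on with
    | C a =>
      rw [MvPolynomial.aeval_C, MvPolynomial.aeval_C, hα, PowerSeries.algebraMap_eq]
    | add p q hp hq => simp only [map_add, hp, hq]
    | mul_X p n hp => simp only [map_mul, hp, MvPolynomial.aeval_X]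
  rw [painleveTwo, hz, hα, picard]
  simp only [hw, derivInf_ofPowerSeries, ← map_pow, ← map_sub, hit, hae]
  rw [show (2 : LaurentSeries ℂ) = HahnSeries.ofPowerSeries ℤ ℂ 2 from (map_ofNat _ 2).symm]
  simp only [← map_mul, ← map_add, ← map_sub]
  congr 1
  ring

theorem dvd_psDeriv_sub {k : ℕ} {f g : PowerSeries ℂ} (h : PowerSeries.X ^ k ∣ f - g) :
    PowerSeries.X ^ (k + 1) ∣ psDeriv f - psDeriv g := by
  obtain ⟨q, hq⟩ := h
  have h1 : psDeriv f - psDeriv g = psDeriv (PowerSeries.X ^ k * q) := by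
    rw [← hq, psDeriv, psDeriv, psDeriv, map_sub]; ring
  rw [h1, psDeriv, Derivation.leibniz, Derivation.leibniz_pow, PowerSeries.derivative_X, dvd_neg]
  cases k with
  | zero => exact Dvd.dvd.mul_right (pow_dvd_pow _ (by norm_num)) _
  | succ k =>
    refine ⟨PowerSeries.X * PowerSeries.derivative ℂ q + (k + 1 : ℕ) • q, ?_⟩
    simp only [smul_eq_mul, nsmul_eq_mul, Nat.add_sub_cancel]
    ring

theorem dvd_picard_sub (N : ℕ) (α : ℂ) {k : ℕ} {f g : PowerSeries ℂ}
    (h : PowerSeries.X ^ k ∣ f - g) :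
    PowerSeries.X ^ (k + 1) ∣ picard N α f - picard N α g := by
  have hw : PowerSeries.X ^ (k + 1) ∣ PowerSeries.X * f - PowerSeries.X * g := by
    rw [← mul_sub, pow_succ']; exact mul_dvd_mul_left _ h
  have hu : PowerSeries.X ^ (k + 1) ∣ (psDeriv (PowerSeries.X * f) - (PowerSeries.X * f) ^ 2)
      - (psDeriv (PowerSeries.X * g) - (PowerSeries.X * g) ^ 2) := by
    rw [sub_sub_sub_comm]
    exact dvd_sub ((pow_dvd_pow _ (Nat.le_succ _)).trans (dvd_psDeriv_sub hw))
      (hw.trans (sub_dvd_pow_sub_pow _ _ 2))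
  have hit : ∀ (j : ℕ) (a b : PowerSeries ℂ), PowerSeries.X ^ (k + 1) ∣ a - b →
      PowerSeries.X ^ (k + 1) ∣ psDeriv^[j] a - psDeriv^[j] b := by
    intro j
    induction j with
    | zero => intro a b hab; exact hab
    | succ j ih =>
      intro a b hab
      exact ih _ _ ((pow_dvd_pow _ (Nat.le_succ _)).trans (dvd_psDeriv_sub hab))
  have hae : ∀ (a b : ℕ → PowerSeries ℂ), (∀ j, PowerSeries.X ^ (k + 1) ∣ a j - b j) →
      ∀ P : DiffPoly, PowerSeries.X ^ (k + 1) ∣ MvPolynomial.aeval a P - MvPolynomial.aeval b P := by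
    intro a b hab P
    induction P using MvPolynomial.induction_on with
    | C r => simp
    | add p q hp hq =>
      rw [map_add, map_add, add_sub_add_comm]; exact dvd_add hp hq
    | mul_X p n hp =>
      rw [map_mul, map_mul, MvPolynomial.aeval_X, MvPolynomial.aeval_X]
      have e : MvPolynomial.aeval a p * a n - MvPolynomial.aeval b p * b n
          = (MvPolynomial.aeval a p - MvPolynomial.aeval b p) * a n
            + MvPolynomial.aeval b p * (a n - b n) := by ring
      rw [e]
      exact dvd_add (hp.mul_right _) ((hab n).mul_left _)
  have hl := hae _ _ (fun j => hit j _ _ hu) (lenard N)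
  simp only [picard]
  set a := MvPolynomial.aeval (fun j : ℕ =>
    psDeriv^[j] (psDeriv (PowerSeries.X * f) - (PowerSeries.X * f) ^ 2)) (lenard N)
  set b := MvPolynomial.aeval (fun j : ℕ =>
    psDeriv^[j] (psDeriv (PowerSeries.X * g) - (PowerSeries.X * g) ^ 2)) (lenard N)
  have hd := (pow_dvd_pow _ (Nat.le_succ (k + 1))).trans (dvd_psDeriv_sub hl)
  have e : psDeriv a + 2 * (PowerSeries.X * f) * a - PowerSeries.C α
      - (psDeriv b + 2 * (PowerSeries.X * g) * b - PowerSeries.C α)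
      = (psDeriv a - psDeriv b) + (2 * (PowerSeries.X * f) * (a - b)
        + 2 * b * (PowerSeries.X * f - PowerSeries.X * g)) := by ring
  rw [e]
  exact dvd_add hd (dvd_add (hl.mul_left _) (hw.mul_left _))

/-- There is exactly one formal solution at infinity for every value of the parameter. -/
theorem existsUnique_isFormalSolution (N : ℕ) (α : ℂ) : ∃! c, IsFormalSolution N α c := by
  have hiff : ∀ c, IsFormalSolution N α c ↔ picard N α (PowerSeries.mk c) = PowerSeries.mk c := by
    intro c
    rw [IsFormalSolution, painleveTwo_seriesInf,
      map_eq_zero_iff _ HahnSeries.ofPowerSeries_injective, sub_eq_zero]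
  have hext : ∀ f g : PowerSeries ℂ, (∀ k, PowerSeries.X ^ k ∣ f - g) → f = g := by
    intro f g h
    ext n
    have := (PowerSeries.X_pow_dvd_iff.mp (h (n + 1))) n (Nat.lt_succ_self n)
    rwa [map_sub, sub_eq_zero] at this
  let W : ℕ → PowerSeries ℂ := fun k => (picard N α)^[k] 0
  have hW : ∀ k, W (k + 1) = picard N α (W k) := fun k => Function.iterate_succ_apply' _ _ _
  have hstep : ∀ k, PowerSeries.X ^ k ∣ W (k + 1) - W k := by
    intro k
    induction k with
    | zero => simp
    | succ k ih => rw [hW (k + 1), hW k]; rw [hW k] at ih; exact dvd_picard_sub N α ih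
  have hfar : ∀ k j, PowerSeries.X ^ k ∣ W (k + j) - W k := by
    intro k j
    induction j with
    | zero => simp
    | succ j ih =>
      have := dvd_add ((pow_dvd_pow _ (Nat.le_add_right k j)).trans (hstep (k + j))) ih
      rwa [sub_add_sub_cancel] at this
  let c : ℕ → ℂ := fun m => PowerSeries.coeff m (W (m + 1))
  have hc : ∀ k, PowerSeries.X ^ k ∣ PowerSeries.mk c - W k := by
    intro k
    rw [PowerSeries.X_pow_dvd_iff]
    intro m hm
    obtain ⟨j, rfl⟩ := Nat.exists_eq_add_of_lt hm
    have := (PowerSeries.X_pow_dvd_iff.mp (hfar (m + 1) j)) m (Nat.lt_succ_self m)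
    rw [map_sub, sub_eq_zero] at this
    rw [map_sub, PowerSeries.coeff_mk, sub_eq_zero, show m + j + 1 = m + 1 + j by ring, this]
  have hcs : picard N α (PowerSeries.mk c) = PowerSeries.mk c := by
    refine hext _ _ fun k => ?_
    have h1 := (pow_dvd_pow _ (Nat.le_succ k)).trans (dvd_picard_sub N α (hc k))
    rw [← hW] at h1
    have h2 := (pow_dvd_pow _ (Nat.le_succ k)).trans (hc (k + 1))
    have := dvd_sub h1 h2
    rwa [sub_sub_sub_cancel_right] at this
  refine ⟨c, (hiff c).mpr hcs, fun b hb => ?_⟩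
  have hb' : picard N α (PowerSeries.mk b) = PowerSeries.mk b := (hiff b).mp hb
  have heq : PowerSeries.mk b = PowerSeries.mk c := by
    refine hext _ _ fun k => ?_
    induction k with
    | zero => simp
    | succ k ih => rw [← hb', ← hcs]; exact dvd_picard_sub N α ih
  funext m
  simpa using congrArg (PowerSeries.coeff m) heq

/-- `expansionCoeff N α m` is the coefficient of `z^(-m-1)` in the expansion at infinity of the
formal solution of the `N`-th equation with parameter `α`. By uniqueness this is the expansion
`w = -α / z + ∑_{l ≥ 1} c_((2 N + 1) l) z^(-(2 N + 1) l - 1)`. -/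
def expansionCoeff (N : ℕ) (α : ℂ) : ℕ → ℂ := (existsUnique_isFormalSolution N α).choose

theorem isFormalSolution_expansionCoeff (N : ℕ) (α : ℂ) :
    IsFormalSolution N α (expansionCoeff N α) := (existsUnique_isFormalSolution N α).choose_spec.1

end PIIHierarchy

end

/-
A rational function is determined by its expansion at infinity, and expanding
`d/dz log (P / Q)` gives `∑ 1 / (z - a) - ∑ 1 / (z - b)` over the roots `a` of `P` and `b` of `Q`,
whose coefficients are the differences of the power sums of the roots. Expansion commutes with
`d/dz`, so for `P = Q_{i-1}` and `Q = Q_i` it yields a formal solution with parameter `i`, and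
uniqueness identifies those differences with the coefficients `c_{i,-(m+1)}`; the sum over `i`
telescopes. For `i = 1` the solution is `-1 / z`, because `u = w' - w ^ 2` vanishes and `L_N` has
no constant term for `N ≥ 1`, so the first summand only contributes when `m = 0`.
-/

noncomputable section

namespace PIIHierarchy

section RatFuncAeval

variable {k K : Type*} [Field k] [Field K] [Algebra k K] {x : K}

theorem transcendental_of_derivation_ne_zero [PerfectField k] (D : Derivation k K K)
    (hx : D x ≠ 0) : Transcendental k x := by
  intro halg
  have hsep : (minpoly k x).Separable :=
    PerfectField.separable_of_irreducible (minpoly.irreducible halg.isIntegral)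
  have hD : aeval x (derivative (minpoly k x)) * D x = 0 := by
    rw [← smul_eq_mul, ← Derivation.map_aeval, minpoly.aeval, map_zero]
  exact hsep.aeval_derivative_ne_zero (minpoly.aeval k x) ((mul_eq_zero_iff_right hx).mp hD)

theorem aeval_derivative_div_aeval {p : k[X]} (hp : p.Splits) (hx : aeval x p ≠ 0) :
    aeval x (derivative p) / aeval x p
      = (p.roots.map fun a => (x - algebraMap k K a)⁻¹).sum := by
  have hsplits := hp.map (algebraMap k K)
  rw [← eval_map_algebraMap] at hx
  rw [← eval_map_algebraMap, ← eval_map_algebraMap, ← derivative_map,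
    hsplits.eval_derivative_div_eval_of_ne_zero hx, hp.roots_map, Multiset.map_map]
  simp only [Function.comp_def, one_div]

/-- Substitution of a transcendental element `x` of an extension field for the variable of a
rational function. With `x = z` in the Laurent series in `1 / z` it is the expansion at
infinity. -/
def ratFuncAeval (hx : Transcendental k x) : RatFunc k →ₐ[k] K :=
  RatFunc.liftAlgHom (aeval x)
    (nonZeroDivisors_le_comap_nonZeroDivisors_of_injective _ (transcendental_iff_injective.mp hx))

theorem ratFuncAeval_algebraMap (hx : Transcendental k x) (p : k[X]) :
    ratFuncAeval hx (algebraMap k[X] (RatFunc k) p) = aeval x p :=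
  RatFunc.liftRingHom_algebraMap _ _ p

theorem ratFuncAeval_X (hx : Transcendental k x) : ratFuncAeval hx RatFunc.X = x := by
  rw [← RatFunc.algebraMap_X, ratFuncAeval_algebraMap, aeval_X]

end RatFuncAeval

section DifferentialField

variable {K : Type*} [Field K] [Algebra ℂ K] {D : Derivation ℂ K K} {z : K}

theorem ratFuncAeval_ratDeriv (hz : Transcendental ℂ z) (hDz : D z = 1) (f : RatFunc ℂ) :
    ratFuncAeval hz (ratDeriv f) = D (ratFuncAeval hz f) := by
  have hquot : ratFuncAeval hz f = aeval z f.num / aeval z f.denom :=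
    RatFunc.liftAlgHom_apply _ _ f
  rw [hquot, Derivation.leibniz_div, Derivation.map_aeval, Derivation.map_aeval, hDz, ratDeriv]
  simp only [map_div₀, map_sub, map_mul, map_pow, ratFuncAeval_algebraMap, smul_eq_mul, mul_one]
  ring

theorem ratFuncAeval_logDerivQuot (hz : Transcendental ℂ z) (hDz : D z = 1) {P Q : ℂ[X]}
    (hP : P ≠ 0) (hQ : Q ≠ 0) :
    ratFuncAeval hz (logDerivQuot P Q)
      = (P.roots.map fun a => (z - algebraMap ℂ K a)⁻¹).sum
        - (Q.roots.map fun a => (z - algebraMap ℂ K a)⁻¹).sum := by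
  have hP' : aeval z P ≠ 0 := fun h => hP ((transcendental_iff.mp hz) P h)
  have hQ' : aeval z Q ≠ 0 := fun h => hQ ((transcendental_iff.mp hz) Q h)
  rw [← aeval_derivative_div_aeval (IsAlgClosed.splits P) hP',
    ← aeval_derivative_div_aeval (IsAlgClosed.splits Q) hQ', logDerivQuot, map_div₀,
    ratFuncAeval_ratDeriv hz hDz, map_div₀, ratFuncAeval_algebraMap, ratFuncAeval_algebraMap,
    Derivation.leibniz_div, Derivation.map_aeval, Derivation.map_aeval, hDz]
  simp only [smul_eq_mul, mul_one]
  field_simp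

end DifferentialField

section Hierarchy

theorem map_painleveTwo {A B : Type*} [CommRing A] [Algebra ℂ A] [CommRing B] [Algebra ℂ B]
    (φ : A →ₐ[ℂ] B) {d : A → A} {e : B → B} (hφ : Function.Semiconj φ d e) (z : A) (N : ℕ) (α : ℂ)
    (w : A) : φ (painleveTwo d z N α w) = painleveTwo e (φ z) N α (φ w) := by
  have hiter (j : ℕ) (a : A) : φ (d^[j] a) = e^[j] (φ a) := hφ.iterate_right j a
  simp only [painleveTwo, map_sub, map_add, map_mul, map_pow, map_ofNat, AlgHom.commutes, hφ.eq,
    hiter, MvPolynomial.comp_aeval_apply]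

theorem painleveTwo_of_riccati {A : Type*} [CommRing A] [Algebra ℂ A] {d : A → A} (hd : d 0 = 0)
    {N : ℕ} (hN : 1 ≤ N) {w : A} (hw : d w = w ^ 2) (z : A) (α : ℂ) :
    painleveTwo d z N α w = -(z * w) - algebraMap ℂ A α := by
  have hiter (j : ℕ) : d^[j] 0 = 0 := Function.iterate_fixed hd j
  have hL : MvPolynomial.aeval (fun _ => (0 : A)) (lenard N) = 0 := by
    obtain ⟨k, rfl⟩ := Nat.exists_eq_add_of_le' hN
    rw [MvPolynomial.aeval_zero', isLenardSequence_lenard.constantCoeff, map_zero]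
  simp only [painleveTwo, hw, sub_self, hiter, hL, hd]
  ring

theorem painleveTwo_neg_inv {K : Type*} [Field K] [Algebra ℂ K] {D : Derivation ℂ K K} {z : K}
    (hDz : D z = 1) {N : ℕ} (hN : 1 ≤ N) : painleveTwo D z N 1 (-z⁻¹) = 0 := by
  have hz : z ≠ 0 := by
    rintro rfl
    simp at hDz
  have hriccati : D (-z⁻¹) = (-z⁻¹) ^ 2 := by
    rw [map_neg, Derivation.leibniz_inv, hDz, smul_eq_mul]
    ring
  rw [painleveTwo_of_riccati D.map_zero hN hriccati, mul_neg, mul_inv_cancel₀ hz, map_one]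
  ring

end Hierarchy

section DerivationAtInfinity

/-- The Euler operator `∑ r_g t ^ g ↦ ∑ χ(g) r_g t ^ g` on Hahn series, a derivation for every
additive character `χ` of the exponents. For Laurent series and `χ(n) = n` it is `t d/dt`. -/
def eulerDerivation {Γ R : Type*} [AddCommMonoid Γ] [PartialOrder Γ] [IsOrderedCancelAddMonoid Γ]
    [CommRing R] (χ : Γ →+ R) : Derivation R (HahnSeries Γ R) (HahnSeries Γ R) :=
  have hsupp (f : HahnSeries Γ R) : (Function.support fun g => χ g * f.coeff g) ⊆ f.support :=
    Function.support_mul_subset_right _ _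
  let euler : HahnSeries Γ R →ₗ[R] HahnSeries Γ R :=
    { toFun := fun f => ⟨fun g => χ g * f.coeff g, f.isPWO_support.mono (hsupp f)⟩
      map_add' := fun f g => by ext; exact mul_add _ _ _
      map_smul' := fun r f => by ext; exact mul_left_comm _ _ _ }
  Derivation.mk' euler fun f g => by
    have heuler (f : HahnSeries Γ R) (n : Γ) : (euler f).coeff n = χ n * f.coeff n := rfl
    rw [smul_eq_mul, smul_eq_mul, mul_comm g]
    ext n
    rw [HahnSeries.coeff_add, heuler, HahnSeries.coeff_mul,
      HahnSeries.coeff_mul_right' g.isPWO_support (show (euler g).support ⊆ _ from hsupp g),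
      HahnSeries.coeff_mul_left' f.isPWO_support (show (euler f).support ⊆ _ from hsupp f),
      ← Finset.sum_add_distrib, Finset.mul_sum]
    refine Finset.sum_congr rfl fun ij hij => ?_
    rw [heuler, heuler, ← (Finset.mem_antidiagonal.mp hij).2.2, map_add]
    ring

theorem coeff_eulerDerivation {Γ R : Type*} [AddCommMonoid Γ] [PartialOrder Γ]
    [IsOrderedCancelAddMonoid Γ] [CommRing R] (χ : Γ →+ R) (f : HahnSeries Γ R) (g : Γ) :
    (eulerDerivation χ f).coeff g = χ g * f.coeff g :=
  rfl

theorem derivInf_eq_neg_mul_eulerDerivation (f : LaurentSeries ℂ) :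
    derivInf f = -HahnSeries.single 1 1 * eulerDerivation (Int.castAddHom ℂ) f := by
  ext n
  rw [derivInf, neg_mul, HahnSeries.coeff_neg, HahnSeries.coeff_neg, HahnSeries.coeff_single_mul,
    HahnSeries.coeff_single_mul, coeff_eulerDerivation, LaurentSeries.derivative_apply,
    LaurentSeries.hasseDeriv_coeff]
  simp [show n - 2 + 1 = n - 1 by ring]

theorem derivInf_add (f g : LaurentSeries ℂ) : derivInf (f + g) = derivInf f + derivInf g := by
  simp only [derivInf_eq_neg_mul_eulerDerivation, map_add, mul_add]

theorem derivInf_mul (f g : LaurentSeries ℂ) :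
    derivInf (f * g) = f * derivInf g + g * derivInf f := by
  simp only [derivInf_eq_neg_mul_eulerDerivation, Derivation.leibniz, smul_eq_mul]
  ring

theorem derivInf_algebraMap (a : ℂ) : derivInf (algebraMap ℂ (LaurentSeries ℂ) a) = 0 := by
  rw [HahnSeries.algebraMap_apply', PowerSeries.algebraMap_eq, HahnSeries.ofPowerSeries_C,
    HahnSeries.C_apply, derivInf, LaurentSeries.derivative_apply, LaurentSeries.hasseDeriv_single]
  simp

/-- The derivation given by an additive map that satisfies the Leibniz rule and kills the
constants. -/
def derivationOfLeibniz {k A : Type*} [CommRing k] [CommRing A] [Algebra k A] (D : A →+ A)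
    (hleibniz : ∀ f g, D (f * g) = f * D g + g * D f) (hconst : ∀ a, D (algebraMap k A a) = 0) :
    Derivation k A A :=
  Derivation.mk'
    { D with
      map_smul' := fun a f => by
        change D (a • f) = a • D f
        rw [Algebra.smul_def, hleibniz, hconst, mul_zero, add_zero, Algebra.smul_def] }
    hleibniz

/-- The derivation `d/dz` of the Laurent series at infinity, that is `derivInf` bundled. The scalar
action is given explicitly because instance search finds `HahnSeries.instModule`, which does not
unify with the action of the algebra structure. -/
def derivationInf : @Derivation ℂ (LaurentSeries ℂ) (LaurentSeries ℂ) _ _ _ _ _ Algebra.toModule :=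
  derivationOfLeibniz (AddMonoidHom.mk' derivInf derivInf_add) derivInf_mul derivInf_algebraMap

theorem coe_derivationInf : ⇑derivationInf = derivInf :=
  rfl

theorem derivationInf_zInf : derivationInf zInf = 1 := by
  rw [coe_derivationInf, derivInf, zInf, LaurentSeries.derivative_apply,
    LaurentSeries.hasseDeriv_single, HahnSeries.single_mul_single]
  simp

theorem transcendental_zInf : Transcendental ℂ zInf :=
  transcendental_of_derivation_ne_zero derivationInf (derivationInf_zInf ▸ one_ne_zero)

end DerivationAtInfinity

section PowerSums

/-- The coefficients `c` are sent to `∑ c_m z^(-m-1)`; this is `seriesInf` as an additive map. -/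
def seriesInfHom : (ℕ → ℂ) →+ LaurentSeries ℂ :=
  AddMonoidHom.mk' seriesInf fun b c => by
    have hmk : PowerSeries.mk (b + c) = PowerSeries.mk b + PowerSeries.mk c := rfl
    rw [seriesInf, hmk, map_add, mul_add, seriesInf, seriesInf]

theorem inv_zInf_sub_algebraMap (a : ℂ) :
    (zInf - algebraMap ℂ (LaurentSeries ℂ) a)⁻¹ = seriesInf fun m => a ^ m := by
  have hgeom : (1 - PowerSeries.C a * PowerSeries.X) * PowerSeries.mk (fun m => a ^ m) = 1 := by
    ext (_ | m) <;>
      simp [sub_mul, mul_assoc, PowerSeries.coeff_succ_X_mul, PowerSeries.coeff_one, pow_succ']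
  have hz : (zInf - algebraMap ℂ (LaurentSeries ℂ) a) * HahnSeries.single 1 1
      = HahnSeries.ofPowerSeries ℤ ℂ (1 - PowerSeries.C a * PowerSeries.X) := by
    rw [HahnSeries.algebraMap_apply', PowerSeries.algebraMap_eq, sub_mul, zInf,
      HahnSeries.single_mul_single, map_sub, RingHom.map_mul, HahnSeries.ofPowerSeries_X]
    simp
  refine inv_eq_of_mul_eq_one_right ?_
  rw [seriesInf, ← mul_assoc, hz, ← map_mul, hgeom, map_one]

theorem seriesInf_rootPowerSum (Q : ℂ[X]) :
    seriesInf (rootPowerSum Q)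
      = (Q.roots.map fun a => (zInf - algebraMap ℂ (LaurentSeries ℂ) a)⁻¹).sum := by
  have hsum : rootPowerSum Q = (Q.roots.map fun a m => a ^ m).sum := by
    funext m
    rw [Pi.multiset_sum_apply, Multiset.map_map]
    rfl
  change seriesInfHom _ = _
  rw [hsum, map_multiset_sum, Multiset.map_map]
  simp only [inv_zInf_sub_algebraMap]
  rfl

theorem ratFuncAeval_zInf_logDerivQuot {P Q : ℂ[X]} (hP : P ≠ 0) (hQ : Q ≠ 0) :
    ratFuncAeval transcendental_zInf (logDerivQuot P Q)
      = seriesInf (rootPowerSum P - rootPowerSum Q) := by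
  rw [ratFuncAeval_logDerivQuot _ derivationInf_zInf hP hQ, ← seriesInf_rootPowerSum,
    ← seriesInf_rootPowerSum]
  exact (map_sub seriesInfHom _ _).symm

theorem rootPowerSum_zero (Q : ℂ[X]) : rootPowerSum Q 0 = Q.natDegree := by
  simp [rootPowerSum, (IsAlgClosed.splits Q).natDegree_eq_card_roots]

end PowerSums

section FormalSolutions

theorem IsFormalSolution.eq_expansionCoeff {N : ℕ} {α : ℂ} {c : ℕ → ℂ}
    (hc : IsFormalSolution N α c) : c = expansionCoeff N α :=
  (existsUnique_isFormalSolution N α).unique hc (isFormalSolution_expansionCoeff N α)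

theorem expansionCoeff_one {N : ℕ} (hN : 1 ≤ N) :
    expansionCoeff N 1 = -fun m => (0 : ℂ) ^ m := by
  have hinv : seriesInf (-fun m => (0 : ℂ) ^ m) = -zInf⁻¹ := by
    have h := inv_zInf_sub_algebraMap 0
    rw [map_zero, sub_zero] at h
    rw [h]
    exact map_neg seriesInfHom _
  refine (IsFormalSolution.eq_expansionCoeff ?_).symm
  rw [IsFormalSolution, hinv, ← coe_derivationInf]
  exact painleveTwo_neg_inv derivationInf_zInf hN

theorem rootPowerSum_sub_rootPowerSum {N : ℕ} {α : ℂ} {P Q : ℂ[X]} (hP : P ≠ 0) (hQ : Q ≠ 0)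
    (hw : painleveTwo ratDeriv RatFunc.X N α (logDerivQuot P Q) = 0) :
    rootPowerSum P - rootPowerSum Q = expansionCoeff N α := by
  have hexpand := map_painleveTwo (ratFuncAeval transcendental_zInf)
    (ratFuncAeval_ratDeriv transcendental_zInf derivationInf_zInf) RatFunc.X N α (logDerivQuot P Q)
  rw [hw, map_zero, ratFuncAeval_X, ratFuncAeval_zInf_logDerivQuot hP hQ, coe_derivationInf]
    at hexpand
  exact IsFormalSolution.eq_expansionCoeff hexpand.symm

theorem IsYablonskiiVorobev.ne_zero {N n : ℕ} {Q : ℂ[X]} (hQ : IsYablonskiiVorobev N n Q) :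
    Q ≠ 0 := by
  cases hQ with
  | zero => exact one_ne_zero
  | succ _ hmonic _ => exact hmonic.ne_zero

theorem IsYablonskiiVorobev.rootPowerSum_eq {N n : ℕ} {Q : ℂ[X]} (hQ : IsYablonskiiVorobev N n Q)
    (m : ℕ) : rootPowerSum Q m = -∑ i ∈ Finset.Icc 1 n, expansionCoeff N (i : ℂ) m := by
  induction hQ with
  | zero => simp [rootPowerSum]
  | @succ n P Q hP hmonic hw ih =>
    have hdiff : rootPowerSum P m - rootPowerSum Q m = expansionCoeff N (n + 1 : ℂ) m :=
      congrFun (rootPowerSum_sub_rootPowerSum hP.ne_zero hmonic.ne_zero hw) m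
    rw [Finset.sum_Icc_succ_top (Nat.succ_pos n), Nat.cast_succ]
    linear_combination ih - hdiff

end FormalSolutions

end PIIHierarchy

end

theorem theorem2 (N n : ℕ) (hN : 1 ≤ N) (hn : 2 ≤ n) (Q : ℂ[X])
    (hQ : PIIHierarchy.IsYablonskiiVorobev N n Q) :
    (∀ m : ℕ, 1 ≤ m → PIIHierarchy.rootPowerSum Q m =
      -∑ i ∈ Finset.Icc 2 n, PIIHierarchy.expansionCoeff N (i : ℂ) m) ∧
    (Q.natDegree : ℂ) = -∑ i ∈ Finset.Icc 1 n, PIIHierarchy.expansionCoeff N (i : ℂ) 0 := by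
  refine ⟨fun m hm => ?_, ?_⟩
  · have hfirst : PIIHierarchy.expansionCoeff N ((1 : ℕ) : ℂ) m = 0 := by
      rw [Nat.cast_one, PIIHierarchy.expansionCoeff_one hN, Pi.neg_apply,
        zero_pow (Nat.one_le_iff_ne_zero.mp hm), neg_zero]
    rw [hQ.rootPowerSum_eq, ← Finset.add_sum_Ioc_eq_sum_Icc (Nat.one_le_of_lt hn), hfirst, zero_add]
    rfl
  · rw [← PIIHierarchy.rootPowerSum_zero, hQ.rootPowerSum_eq]
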